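/- Let $(M,g)$ be a smooth $(n+1)$-dimensional pseudo-Riemannian manifold of Lorentzian signature $(n,1)$, with Levi-Civita connection $\nabla$. Let $V$ be a (smoothly immersed) lightlike hypersurface of $M$, i.e. $\dim V=n$ and every tangent hyperplane $T_xV\subset T_xM$ is tangent to the isotropic cone $C_x=\{\xi\in T_xM : g(\xi,\xi)=0\}$, which means that $T_xV$ contains a nonzero vector $e_1$ that is $g$-orthogonal to all of $T_xV$ (this vector is isotropic, and $T_xV\cap C_x$ is the line spanned by it). An isotropic line of $V$ is an integral curve of the direction field $e_1$, i.e. a smooth curve $\gamma: J\to V$ on an open interval $J$ with $\gamma'(t)\neq 0$ and $g(\gamma'(t),\gamma'(t))=0$ for all $t\in J$. Then every isotropic line $\gamma$ of $V$ is a geodesic line of $(M,g)$: it is a smooth regular curve in $M$, and there is a smooth 1-form $\alpha(t)\,dt$ on $J$ such that $\nabla_{\gamma'}\gamma'=\alpha\,\gamma'$ on $J$, i.e. in every chart of $M$ $$\ddot\gamma^k+\sum_{i,j}\Gamma^k_{ij}\,\dot\gamma^i\dot\gamma^j=\alpha\,\dot\gamma^k \quad\text{for all } k .$$ -/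

import Mathlib

open scoped Manifold ContDiff

noncomputable section

/-- A smooth pseudo-Riemannian metric of Lorentzian signature `(n, 1)` on an
`(n + 1)`-dimensional smooth manifold `M`. -/
structure LorentzianMetric (n : ℕ) (M : Type*) [TopologicalSpace M]
    [ChartedSpace (EuclideanSpace ℝ (Fin (n + 1))) M] [IsManifold (𝓡 (n + 1)) ∞ M] where
  /-- The scalar product on the tangent spaces. -/
  val (x : M) : TangentSpace (𝓡 (n + 1)) x →L[ℝ] TangentSpace (𝓡 (n + 1)) x →L[ℝ] ℝ
  symm (x : M) (v w : TangentSpace (𝓡 (n + 1)) x) : val x v w = val x w v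
  sigPos_eq (x : M) :
    sigPos (LinearMap.BilinMap.toQuadraticMap (val x).toLinearMap₁₂) = n
  sigNeg_eq (x : M) :
    sigNeg (LinearMap.BilinMap.toQuadraticMap (val x).toLinearMap₁₂) = 1
  contMDiff : ContMDiff (𝓡 (n + 1))
    ((𝓡 (n + 1)).prod 𝓘(ℝ, EuclideanSpace ℝ (Fin (n + 1)) →L[ℝ]
      EuclideanSpace ℝ (Fin (n + 1)) →L[ℝ] ℝ)) ∞
    (fun x : M ↦ Bundle.TotalSpace.mk' (EuclideanSpace ℝ (Fin (n + 1)) →L[ℝ]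
      EuclideanSpace ℝ (Fin (n + 1)) →L[ℝ] ℝ)
      (E := fun x : M ↦ TangentSpace (𝓡 (n + 1)) x →L[ℝ] TangentSpace (𝓡 (n + 1)) x →L[ℝ] ℝ)
      x (val x))

/-- The velocity vector of a curve `c : ℝ → N` at time `t`. -/
def curveVelocity (m : ℕ) {N : Type*} [TopologicalSpace N]
    [ChartedSpace (EuclideanSpace ℝ (Fin m)) N] (c : ℝ → N) (t : ℝ) :
    TangentSpace (𝓡 m) (c t) :=
  mfderiv 𝓘(ℝ, ℝ) (𝓡 m) c t (1 : ℝ)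

/-- The `i`-th coordinate vector field `∂ᵢ` of a chart `e`, at the point with coordinates `y`. -/
def coordVector {m : ℕ} {M : Type*} [TopologicalSpace M]
    [ChartedSpace (EuclideanSpace ℝ (Fin m)) M]
    (e : OpenPartialHomeomorph M (EuclideanSpace ℝ (Fin m))) (i : Fin m)
    (y : EuclideanSpace ℝ (Fin m)) : TangentSpace (𝓡 m) (e.symm y) :=
  mfderiv (𝓡 m) (𝓡 m) e.symm y (EuclideanSpace.single i (1 : ℝ) : EuclideanSpace ℝ (Fin m))

/-- The partial derivative `∂f/∂yⁱ` of a real function on `ℝᵐ`. -/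
def partialDeriv {m : ℕ} (i : Fin m) (f : EuclideanSpace ℝ (Fin m) → ℝ)
    (y : EuclideanSpace ℝ (Fin m)) : ℝ :=
  fderiv ℝ f y (EuclideanSpace.single i (1 : ℝ))

namespace LorentzianMetric

variable {n : ℕ} {M : Type*} [TopologicalSpace M]
  [ChartedSpace (EuclideanSpace ℝ (Fin (n + 1))) M] [IsManifold (𝓡 (n + 1)) ∞ M]

/-- The matrix `gᵢⱼ = g(∂ᵢ, ∂ⱼ)` of the metric in the chart `e`, as a function of the
coordinates. -/
def coeff (g : LorentzianMetric n M)
    (e : OpenPartialHomeomorph M (EuclideanSpace ℝ (Fin (n + 1))))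
    (y : EuclideanSpace ℝ (Fin (n + 1))) : Matrix (Fin (n + 1)) (Fin (n + 1)) ℝ :=
  Matrix.of fun i j ↦ g.val (e.symm y) (coordVector e i y) (coordVector e j y)

/-- The Christoffel symbols
`Γᵏᵢⱼ = ½ ∑ₗ gᵏˡ (∂ᵢ gⱼₗ + ∂ⱼ gᵢₗ - ∂ₗ gᵢⱼ)` of the Levi-Civita connection in the chart `e`. -/
def christoffel (g : LorentzianMetric n M)
    (e : OpenPartialHomeomorph M (EuclideanSpace ℝ (Fin (n + 1))))
    (k i j : Fin (n + 1)) (y : EuclideanSpace ℝ (Fin (n + 1))) : ℝ :=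
  (1 / 2 : ℝ) * ∑ l, (g.coeff e y)⁻¹ k l *
    (partialDeriv i (fun z ↦ g.coeff e z j l) y + partialDeriv j (fun z ↦ g.coeff e z i l) y
      - partialDeriv l (fun z ↦ g.coeff e z i j) y)

/-- `γ`, restricted to the open set `J` of parameters, is a geodesic line of `(M, g)`, with an
arbitrary regular smooth parametrization: there is a smooth 1-form `α(t) dt` on `J` such that
`∇_{γ'} γ' = α γ'`, that is, `(γᵏ)'' + ∑ Γᵏᵢⱼ (γⁱ)' (γʲ)' = α (γᵏ)'` in every chart of `M`. -/
structure IsGeodesicLine (g : LorentzianMetric n M) (γ : ℝ → M) (J : Set ℝ) : Prop where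
  contMDiffOn : ContMDiffOn 𝓘(ℝ, ℝ) (𝓡 (n + 1)) ∞ γ J
  regular : ∀ t ∈ J, curveVelocity (n + 1) γ t ≠ 0
  geodesic_eq : ∃ α : ℝ → ℝ, ContDiffOn ℝ ∞ α J ∧
    ∀ e ∈ IsManifold.maximalAtlas (𝓡 (n + 1)) ∞ M, ∀ t ∈ J, γ t ∈ e.source → ∀ k,
      deriv (deriv fun s ↦ e (γ s) k) t
        + ∑ i, ∑ j, g.christoffel e k i j (e (γ t))
          * deriv (fun s ↦ e (γ s) i) t * deriv (fun s ↦ e (γ s) j) t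
        = α t * deriv (fun s ↦ e (γ s) k) t

variable {V : Type*} [TopologicalSpace V] [ChartedSpace (EuclideanSpace ℝ (Fin n)) V]

/-- The `n`-dimensional manifold `V`, immersed in `M` by `ι`, is a lightlike hypersurface: every
tangent hyperplane `η = dι(T_p V)` is tangent to the isotropic cone, i.e. it contains a nonzero
vector orthogonal to all of `η` (in particular isotropic). -/
structure IsLightlikeHypersurface (g : LorentzianMetric n M) (ι : V → M) : Prop where
  contMDiff : ContMDiff (𝓡 n) (𝓡 (n + 1)) ∞ ι
  mfderiv_injective : ∀ p : V, Function.Injective (mfderiv (𝓡 n) (𝓡 (n + 1)) ι p)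
  lightlike : ∀ p : V, ∃ ξ : TangentSpace (𝓡 n) p, ξ ≠ 0 ∧
    ∀ η : TangentSpace (𝓡 n) p,
      g.val (ι p) (mfderiv (𝓡 n) (𝓡 (n + 1)) ι p ξ) (mfderiv (𝓡 n) (𝓡 (n + 1)) ι p η) = 0

/-- The curve `c : J → V` on an open interval `J` is an isotropic line of the hypersurface
`ι : V → M`: a regular smooth curve whose velocity is everywhere isotropic. (On a lightlike
hypersurface each tangent hyperplane contains exactly one isotropic direction, so these are the
regularly parametrized integral curves of that direction.) -/
structure IsIsotropicLine (g : LorentzianMetric n M) (ι : V → M) (c : ℝ → V) (J : Set ℝ) :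
    Prop where
  isOpen : IsOpen J
  ordConnected : J.OrdConnected
  contMDiffOn : ContMDiffOn 𝓘(ℝ, ℝ) (𝓡 n) ∞ c J
  regular : ∀ t ∈ J, curveVelocity n c t ≠ 0
  isotropic : ∀ t ∈ J,
    g.val (ι (c t)) (mfderiv (𝓡 n) (𝓡 (n + 1)) ι (c t) (curveVelocity n c t))
      (mfderiv (𝓡 n) (𝓡 (n + 1)) ι (c t) (curveVelocity n c t)) = 0

end LorentzianMetric

end

/-! The metric induced on a lightlike hypersurface is positive semidefinite: in signature $(n,1)$, a
vector orthogonal to a nonzero isotropic vector cannot be timelike (`form_nonneg_of_orthogonal`). So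
an isotropic line realises the minimum value 0 of the induced energy density at every parameter, and
it must be extremal for the induced energy, even though the induced form is degenerate and has no
Levi-Civita connection.

The argument therefore uses the Euler–Lagrange covector $g(\nabla_{\gamma'}\gamma',\cdot)$, written
in coordinates without inverting the metric, so that it makes sense for degenerate forms. For a
semidefinite form it vanishes along an isotropic curve (`eulerLagrange_eq_zero_of_isotropic`). It is
natural under pullback (`eulerLagrange_pullbackForm`), so the covector of the ambient metric along
$\gamma$ vanishes on the tangent hyperplane of $V$. The covector $g(\gamma',\cdot)$ vanishes there
too and is nonzero. Covectors killing a hyperplane form a line, so the first is $\alpha$ times the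
second (`exists_eulerLagrange_eq_mul`), and raising the index gives the geodesic equation with its
Christoffel symbols.

Naturality applied to transition maps makes $\alpha$ independent of the chart. Its smoothness
follows by writing it locally as a quotient of two smooth functions. -/

/-! ### Calculus of the Euler–Lagrange covector and its naturality -/

section EulerLagrange

open Filter Topology

variable {E F : Type*} [NormedAddCommGroup E] [NormedSpace ℝ E]
  [NormedAddCommGroup F] [NormedSpace ℝ F]

/-- The Euler–Lagrange covector of the energy `½ H_y(y', y')`, evaluated on `w`, for a curve with
position `y`, velocity `v` and acceleration `a`. -/
noncomputable def eulerLagrange (H : F → F →L[ℝ] F →L[ℝ] ℝ) (y v a w : F) : ℝ :=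
  H y a w + fderiv ℝ H y v v w - (1 / 2 : ℝ) * fderiv ℝ H y w v v

/-- The pullback of a field of bilinear forms along a map. -/
noncomputable def pullbackForm (φ : E → F) (H : F → F →L[ℝ] F →L[ℝ] ℝ) (z : E) :
    E →L[ℝ] E →L[ℝ] ℝ :=
  (H (φ z)).bilinearComp (fderiv ℝ φ z) (fderiv ℝ φ z)

@[simp]
theorem pullbackForm_apply (φ : E → F) (H : F → F →L[ℝ] F →L[ℝ] ℝ) (z u v : E) :
    pullbackForm φ H z u v = H (φ z) (fderiv ℝ φ z u) (fderiv ℝ φ z v) := rfl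

theorem eulerLagrange_congr {H H' : F → F →L[ℝ] F →L[ℝ] ℝ} {y : F} (h : H =ᶠ[𝓝 y] H')
    (v a w : F) : eulerLagrange H y v a w = eulerLagrange H' y v a w := by
  simp only [eulerLagrange, h.eq_of_nhds, h.fderiv_eq]

/-- A form built only from compositions of continuous linear maps, to which the product rule
`clm_comp` applies. -/
theorem pullbackForm_eq_comp (φ : E → F) (H : F → F →L[ℝ] F →L[ℝ] ℝ) (z : E) :
    pullbackForm φ H z = (ContinuousLinearMap.compL ℝ E F ℝ).flip (fderiv ℝ φ z) ∘L
      (H (φ z) ∘L fderiv ℝ φ z) := by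
  ext u v
  rfl

theorem differentiableAt_pullbackForm {φ : E → F} {H : F → F →L[ℝ] F →L[ℝ] ℝ} {x : E}
    (hφ : ContDiffAt ℝ 2 φ x) (hH : DifferentiableAt ℝ H (φ x)) :
    DifferentiableAt ℝ (pullbackForm φ H) x := by
  have h1 : DifferentiableAt ℝ φ x := hφ.differentiableAt (by norm_num)
  have h2 : DifferentiableAt ℝ (fderiv ℝ φ) x :=
    (hφ.fderiv_right (m := 1) (by norm_num)).differentiableAt (by norm_num)
  have h3 : DifferentiableAt ℝ (fun z ↦ H (φ z)) x := DifferentiableAt.comp (g := H) x hH h1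
  have : pullbackForm φ H = fun z ↦ (ContinuousLinearMap.compL ℝ E F ℝ).flip (fderiv ℝ φ z) ∘L
      (H (φ z) ∘L fderiv ℝ φ z) := funext (pullbackForm_eq_comp φ H)
  rw [this]
  exact (((ContinuousLinearMap.compL ℝ E F ℝ).flip.differentiableAt.comp x h2).clm_comp
    (h3.clm_comp h2))

theorem fderiv_pullbackForm {φ : E → F} {H : F → F →L[ℝ] F →L[ℝ] ℝ} {x : E}
    (hφ : ContDiffAt ℝ 2 φ x) (hH : DifferentiableAt ℝ H (φ x)) (p u v : E) :
    fderiv ℝ (pullbackForm φ H) x p u v =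
      fderiv ℝ H (φ x) (fderiv ℝ φ x p) (fderiv ℝ φ x u) (fderiv ℝ φ x v)
      + H (φ x) (fderiv ℝ (fderiv ℝ φ) x p u) (fderiv ℝ φ x v)
      + H (φ x) (fderiv ℝ φ x u) (fderiv ℝ (fderiv ℝ φ) x p v) := by
  have h1 : DifferentiableAt ℝ φ x := hφ.differentiableAt (by norm_num)
  have h2 : DifferentiableAt ℝ (fderiv ℝ φ) x :=
    (hφ.fderiv_right (m := 1) (by norm_num)).differentiableAt (by norm_num)
  have h3 : HasFDerivAt (fun z ↦ H (φ z)) ((fderiv ℝ H (φ x)) ∘L fderiv ℝ φ x) x :=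
    HasFDerivAt.comp (g := H) x hH.hasFDerivAt h1.hasFDerivAt
  have hu := h2.hasFDerivAt.clm_apply (hasFDerivAt_const u x)
  have hv := h2.hasFDerivAt.clm_apply (hasFDerivAt_const v x)
  have h4 := ((h3.clm_apply hu).clm_apply hv)
  have hP := ((differentiableAt_pullbackForm hφ hH).hasFDerivAt.clm_apply
    (hasFDerivAt_const u x)).clm_apply (hasFDerivAt_const v x)
  have := congrArg (fun L ↦ L p) (hP.unique h4)
  simp at this
  rw [this]
  ring

/-- The Euler–Lagrange covector is natural under pullback. -/
theorem eulerLagrange_pullbackForm {φ : E → F} {H : F → F →L[ℝ] F →L[ℝ] ℝ} {x : E}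
    (hφ : ContDiffAt ℝ 2 φ x) (hH : DifferentiableAt ℝ H (φ x))
    (hs : ∀ u v, H (φ x) u v = H (φ x) v u) (v a w : E) :
    eulerLagrange (pullbackForm φ H) x v a w =
      eulerLagrange H (φ x) (fderiv ℝ φ x v)
        (fderiv ℝ (fderiv ℝ φ) x v v + fderiv ℝ φ x a) (fderiv ℝ φ x w) := by
  -- The two terms $\tfrac12 H(D^2\varphi(w,v), D\varphi\,v)$ from the energy cancel $H(D\varphi\,v,
  -- D^2\varphi(v,w))$, by symmetry of $D^2\varphi$ and of $H$; only $D^2\varphi(v,v)$ survives, as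
  -- part of the acceleration.
  have hsymm : fderiv ℝ (fderiv ℝ φ) x w v = fderiv ℝ (fderiv ℝ φ) x v w :=
    (hφ.isSymmSndFDerivAt (by simp)) w v
  simp only [eulerLagrange, fderiv_pullbackForm hφ hH, pullbackForm_apply, map_add,
    add_apply]
  rw [hsymm, hs (fderiv ℝ (fderiv ℝ φ) x v w)]
  ring

theorem ContDiffAt.differentiableAt_deriv {x : ℝ → E} {t : ℝ} (hx : ContDiffAt ℝ 2 x t) :
    DifferentiableAt ℝ (deriv x) t := by
  have h : DifferentiableAt ℝ (fderiv ℝ x) t :=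
    (hx.fderiv_right (m := 1) (by norm_num)).differentiableAt (by norm_num)
  exact h.clm_apply (differentiableAt_const (1 : ℝ))

theorem deriv_comp_curve {φ : E → F} {x : ℝ → E} {t : ℝ}
    (hφ : DifferentiableAt ℝ φ (x t)) (hx : DifferentiableAt ℝ x t) :
    deriv (fun s ↦ φ (x s)) t = fderiv ℝ φ (x t) (deriv x t) :=
  (hφ.hasFDerivAt.comp_hasDerivAt t hx.hasDerivAt).deriv

theorem deriv_deriv_comp_curve {φ : E → F} {x : ℝ → E} {t : ℝ}
    (hφ : ContDiffAt ℝ 2 φ (x t)) (hx : ContDiffAt ℝ 2 x t) :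
    deriv (deriv fun s ↦ φ (x s)) t =
      fderiv ℝ (fderiv ℝ φ) (x t) (deriv x t) (deriv x t) + fderiv ℝ φ (x t) (deriv (deriv x) t) := by
  have hev : deriv (fun s ↦ φ (x s)) =ᶠ[𝓝 t] fun s ↦ fderiv ℝ φ (x s) (deriv x s) := by
    filter_upwards [hx.continuousAt.eventually (hφ.eventually (by simp)), hx.eventually (by simp)]
      with s h1 h2
    exact deriv_comp_curve (h1.differentiableAt (by norm_num)) (h2.differentiableAt (by norm_num))
  rw [hev.deriv_eq]
  have h2 : DifferentiableAt ℝ (fderiv ℝ φ) (x t) :=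
    (hφ.fderiv_right (m := 1) (by norm_num)).differentiableAt (by norm_num)
  have h3 : DifferentiableAt ℝ (deriv x) t :=
    hx.differentiableAt_deriv
  exact ((h2.hasFDerivAt.comp_hasDerivAt t
    (hx.differentiableAt (by norm_num)).hasDerivAt).clm_apply h3.hasDerivAt).deriv

/-- Naturality of the Euler–Lagrange covector along a curve `y = φ ∘ x`. -/
theorem eulerLagrange_curve {φ : E → F} {H : F → F →L[ℝ] F →L[ℝ] ℝ} {x : ℝ → E} {y : ℝ → F} {t : ℝ}
    (hφ : ContDiffAt ℝ 2 φ (x t)) (hx : ContDiffAt ℝ 2 x t)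
    (hy : y =ᶠ[𝓝 t] fun s ↦ φ (x s)) (hH : DifferentiableAt ℝ H (y t))
    (hs : ∀ u v, H (y t) u v = H (y t) v u) (w : E) :
    eulerLagrange H (y t) (deriv y t) (deriv (deriv y) t) (fderiv ℝ φ (x t) w) =
      eulerLagrange (pullbackForm φ H) (x t) (deriv x t) (deriv (deriv x) t) w := by
  rw [hy.deriv.deriv_eq, hy.deriv_eq, deriv_deriv_comp_curve hφ hx,
    deriv_comp_curve (hφ.differentiableAt (by norm_num)) (hx.differentiableAt (by norm_num))]
  rw [hy.eq_of_nhds] at hH hs ⊢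
  rw [eulerLagrange_pullbackForm hφ hH hs]

/-- The equality case of Cauchy–Schwarz for a semidefinite form: an isotropic vector lies in the
radical. -/
theorem apply_eq_zero_of_nonneg {B : E →L[ℝ] E →L[ℝ] ℝ} (hs : ∀ u v, B u v = B v u)
    (hB : ∀ u, 0 ≤ B u u) {v : E} (hv : B v v = 0) (w : E) : B v w = 0 := by
  by_contra h
  -- The `+ 1` keeps the denominator positive even if `B w w = 0`; with $q$ the quotient, the value
  -- at this vector is $-q^2(B(w,w)+2) < 0$.
  have key := hB (v - ((B v w) / (B w w + 1)) • w)
  have hw := hB w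
  simp [hv, hs w v] at key
  have : (B v w / (B w w + 1)) * (B w w + 1) = B v w := by field_simp
  have hd : B v w / (B w w + 1) ≠ 0 := by positivity
  set q := B v w / (B w w + 1)
  have hq : 0 < q ^ 2 := by positivity
  have e : q * B v w = q ^ 2 * (B w w + 1) := by rw [← this]; ring
  nlinarith [mul_nonneg hq.le hw]

theorem fderiv_form_apply {h : E → E →L[ℝ] E →L[ℝ] ℝ} {x : E} (hh : DifferentiableAt ℝ h x)
    (u v w : E) : fderiv ℝ (fun z ↦ h z u v) x w = fderiv ℝ h x w u v := by
  have h1 : HasFDerivAt (fun z ↦ h z u) ((fderiv ℝ h x).flip u) x := by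
    simpa using hh.hasFDerivAt.clm_apply (hasFDerivAt_const u x)
  have h2 : HasFDerivAt (fun z ↦ h z u v) (((fderiv ℝ h x).flip u).flip v) x := by
    simpa using h1.clm_apply (hasFDerivAt_const v x)
  rw [h2.fderiv]
  rfl

theorem hasDerivAt_form_curve {h : E → E →L[ℝ] E →L[ℝ] ℝ} {x u : ℝ → E} {x' u' : E} {t : ℝ}
    (hh : DifferentiableAt ℝ h (x t)) (hx : HasDerivAt x x' t) (hu : HasDerivAt u u' t) (w : E) :
    HasDerivAt (fun s ↦ h (x s) (u s) w) (fderiv ℝ h (x t) x' (u t) w + h (x t) u' w) t := by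
  have h1 : HasDerivAt (fun s ↦ h (x s)) (fderiv ℝ h (x t) x') t :=
    HasFDerivAt.comp_hasDerivAt (l := h) t hh.hasFDerivAt hx
  simpa using (h1.clm_apply hu).clm_apply (hasDerivAt_const t w)

/-- A curve that is isotropic for a field of positive semidefinite forms is extremal. -/
theorem eulerLagrange_eq_zero_of_isotropic {h : E → E →L[ℝ] E →L[ℝ] ℝ} {x : ℝ → E} {t : ℝ}
    (hx : ContDiffAt ℝ 2 x t) (hh : DifferentiableAt ℝ h (x t))
    (hs : ∀ᶠ z in 𝓝 (x t), ∀ u v, h z u v = h z v u)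
    (hpos : ∀ᶠ z in 𝓝 (x t), ∀ u, 0 ≤ h z u u)
    (hiso : ∀ᶠ s in 𝓝 t, h (x s) (deriv x s) (deriv x s) = 0) (w : E) :
    eulerLagrange h (x t) (deriv x t) (deriv (deriv x) t) w = 0 := by
  -- With the velocity frozen at time `t`, the energy density is nonnegative nearby and zero at `x
  -- t`, so its first variation in position vanishes.
  have hmin : IsLocalMin (fun z ↦ h z (deriv x t) (deriv x t)) (x t) := by
    filter_upwards [hpos] with z hz
    rw [hiso.self_of_nhds]
    exact hz _
  have h2 := congrArg (fun L ↦ L w) hmin.fderiv_eq_zero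
  simp only [fderiv_form_apply hh, zero_apply] at h2
  have hx1 := (hx.differentiableAt (by norm_num)).hasDerivAt
  have hx2 : DifferentiableAt ℝ (deriv x) t :=
    hx.differentiableAt_deriv
  -- The remaining two terms are the time derivative of the momentum $h(x',w)$ for constant `w`, and
  -- the momentum is identically zero because $x'$ lies in the radical.
  have h3 : (fun s ↦ h (x s) (deriv x s) w) =ᶠ[𝓝 t] fun _ ↦ 0 := by
    filter_upwards [hx.continuousAt.eventually hs, hx.continuousAt.eventually hpos, hiso]
      with s a b c
    exact apply_eq_zero_of_nonneg a b c w
  have h4 := hasDerivAt_form_curve hh hx1 hx2.hasDerivAt w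
  have h5 := h4.deriv.symm.trans (h3.deriv_eq.trans (deriv_const t 0))
  rw [eulerLagrange, h2]
  linarith

end EulerLagrange

/-! ### Covectors vanishing on a hyperplane -/

section LinearAlgebra

theorem exists_eq_smul_of_vanish_on_hyperplane {E F : Type*} [AddCommGroup E] [Module ℝ E]
    [AddCommGroup F] [Module ℝ F] [FiniteDimensional ℝ F] (T : E →ₗ[ℝ] F)
    (hT : Function.Injective T) (hdim : Module.finrank ℝ F = Module.finrank ℝ E + 1)
    {f g : Module.Dual ℝ F} (hf : f ≠ 0) (hfT : ∀ w, f (T w) = 0) (hgT : ∀ w, g (T w) = 0) :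
    ∃ a : ℝ, g = a • f := by
  have h1 := Subspace.finrank_add_finrank_dualAnnihilator_eq (LinearMap.range T)
  rw [LinearMap.finrank_range_of_inj hT, hdim, add_right_inj] at h1
  have hf' : f ∈ (LinearMap.range T).dualAnnihilator := by
    rw [Submodule.mem_dualAnnihilator]
    rintro _ ⟨w, rfl⟩
    exact hfT w
  have hg' : g ∈ (LinearMap.range T).dualAnnihilator := by
    rw [Submodule.mem_dualAnnihilator]
    rintro _ ⟨w, rfl⟩
    exact hgT w
  obtain ⟨a, ha⟩ := exists_smul_eq_of_finrank_eq_one h1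
    (x := ⟨f, hf'⟩) (fun h ↦ hf (congrArg Subtype.val h)) ⟨g, hg'⟩
  exact ⟨a, (congrArg Subtype.val ha).symm⟩

end LinearAlgebra

/-! ### Charts, transition maps and velocities -/

section Charts

variable {m : ℕ} {M : Type*} [TopologicalSpace M] [ChartedSpace (EuclideanSpace ℝ (Fin m)) M]
  {e e' : OpenPartialHomeomorph M (EuclideanSpace ℝ (Fin m))}
  {X : Type*} [NormedAddCommGroup X] [NormedSpace ℝ X]

theorem mdifferentiable_of_mem_maximalAtlas
    (he : e ∈ IsManifold.maximalAtlas (𝓡 m) ∞ M) : e.MDifferentiable (𝓡 m) (𝓡 m) :=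
  ⟨(contMDiffOn_of_mem_maximalAtlas he).mdifferentiableOn (by simp),
    (contMDiffOn_symm_of_mem_maximalAtlas he).mdifferentiableOn (by simp)⟩

/-- The chain rule for $e^{-1}\circ e\circ f = f$ near `p`; it translates coordinate derivatives
into intrinsic tangent vectors. -/
theorem mfderiv_symm_fderiv_comp
    (he : e ∈ IsManifold.maximalAtlas (𝓡 m) ∞ M) {f : X → M} {p : X}
    (hf : MDifferentiableAt 𝓘(ℝ, X) (𝓡 m) f p) (hp : f p ∈ e.source) (u : X) :
    (mfderiv (𝓡 m) (𝓡 m) e.symm (e (f p)) (fderiv ℝ (fun q ↦ e (f q)) p u) :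
      EuclideanSpace ℝ (Fin m)) = mfderiv 𝓘(ℝ, X) (𝓡 m) f p u := by
  have h1 : MDifferentiableAt 𝓘(ℝ, X) (𝓡 m) (fun q ↦ e (f q)) p :=
    ((mdifferentiable_of_mem_maximalAtlas he).mdifferentiableAt hp).comp p hf
  have h2 := (mdifferentiable_of_mem_maximalAtlas he).mdifferentiableAt_symm (e.map_source hp)
  have h3 := mfderiv_comp (I' := 𝓡 m) p h2 h1
  have h4 : (e.symm ∘ fun q ↦ e (f q)) =ᶠ[nhds p] f := by
    filter_upwards [hf.continuousAt.preimage_mem_nhds (e.open_source.mem_nhds hp)] with q hq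
    exact e.left_inv hq
  rw [h4.mfderiv_eq] at h3
  rw [mfderiv_eq_fderiv] at h3
  exact (congrArg (fun L ↦ L u) h3).symm

theorem contDiffAt_chart_curve (he : e ∈ IsManifold.maximalAtlas (𝓡 m) ∞ M) {γ : ℝ → M}
    {t : ℝ} (hγ : ContMDiffAt 𝓘(ℝ, ℝ) (𝓡 m) ∞ γ t) (ht : γ t ∈ e.source) :
    ContDiffAt ℝ ∞ (fun s ↦ e (γ s)) t := by
  rw [← contMDiffAt_iff_contDiffAt]
  exact (contMDiffAt_of_mem_maximalAtlas he ht).comp t hγ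

theorem contDiffAt_transition (he : e ∈ IsManifold.maximalAtlas (𝓡 m) ∞ M)
    (he' : e' ∈ IsManifold.maximalAtlas (𝓡 m) ∞ M) {z : EuclideanSpace ℝ (Fin m)}
    (hz : z ∈ e.target) (hz' : e.symm z ∈ e'.source) :
    ContDiffAt ℝ ∞ (fun q ↦ e' (e.symm q)) z := by
  rw [← contMDiffAt_iff_contDiffAt]
  exact (contMDiffAt_of_mem_maximalAtlas he' hz').comp z (contMDiffAt_symm_of_mem_maximalAtlas he hz)

theorem surjective_fderiv_transition (he : e ∈ IsManifold.maximalAtlas (𝓡 m) ∞ M)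
    (he' : e' ∈ IsManifold.maximalAtlas (𝓡 m) ∞ M) {z : EuclideanSpace ℝ (Fin m)}
    (hz : z ∈ e.target) (hz' : e.symm z ∈ e'.source) :
    Function.Surjective (fderiv ℝ (fun q ↦ e' (e.symm q)) z) := by
  have h := ((mdifferentiable_of_mem_maximalAtlas he).symm.trans
    (mdifferentiable_of_mem_maximalAtlas he')).mfderiv_surjective (x := z) (by simp [hz, hz'])
  rw [mfderiv_eq_fderiv] at h
  exact h

end Charts

/-! ### Signature arguments and the metric in a chart -/

namespace LorentzianMetric

variable {n : ℕ} {M : Type*} [TopologicalSpace M]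
  [ChartedSpace (EuclideanSpace ℝ (Fin (n + 1))) M] [IsManifold (𝓡 (n + 1)) ∞ M]

/-- The scalar product at `x`, as a bilinear form on the model space. -/
noncomputable def form (g : LorentzianMetric n M) (x : M) : EuclideanSpace ℝ (Fin (n + 1)) →L[ℝ]
    EuclideanSpace ℝ (Fin (n + 1)) →L[ℝ] ℝ := g.val x

theorem form_symm (g : LorentzianMetric n M) (x : M) (v w : EuclideanSpace ℝ (Fin (n + 1))) :
    g.form x v w = g.form x w v := g.symm x v w

theorem sigPos_form (g : LorentzianMetric n M) (x : M) :
    sigPos (LinearMap.BilinMap.toQuadraticMap (g.form x).toLinearMap₁₂) = n := g.sigPos_eq x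

theorem sigNeg_form (g : LorentzianMetric n M) (x : M) :
    sigNeg (LinearMap.BilinMap.toQuadraticMap (g.form x).toLinearMap₁₂) = 1 := g.sigNeg_eq x

/-- The indices $n$ and $1$ already add up to the full dimension, which leaves no room for a
radical. -/
theorem form_nondegenerate (g : LorentzianMetric n M) (x : M)
    {v : EuclideanSpace ℝ (Fin (n + 1))} (hv : ∀ w, g.form x v w = 0) : v = 0 := by
  have h := QuadraticForm.sigPos_add_sigNeg_add_radical
    (Q := LinearMap.BilinMap.toQuadraticMap (g.form x).toLinearMap₁₂)
  rw [g.sigPos_form, g.sigNeg_form, finrank_euclideanSpace_fin] at h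
  have h0 : (LinearMap.BilinMap.toQuadraticMap (g.form x).toLinearMap₁₂).radical = ⊥ :=
    Submodule.finrank_eq_zero.mp (by omega)
  rw [← Submodule.mem_bot ℝ, ← h0, QuadraticMap.mem_radical_iff']
  simp [hv, fun w ↦ g.form_symm x w v]

/-- A hyperplane tangent to the isotropic cone is positive semidefinite. -/
theorem form_nonneg_of_orthogonal (g : LorentzianMetric n M) (x : M)
    {ξ η : EuclideanSpace ℝ (Fin (n + 1))} (hξ : ξ ≠ 0) (hξξ : g.form x ξ ξ = 0)
    (hξη : g.form x ξ η = 0) : 0 ≤ g.form x η η := by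
  by_contra! hneg
  have hind : LinearIndependent ℝ ![ξ, η] := by
    rw [LinearIndependent.pair_iff]
    intro s t hst
    have h1 : g.form x η (s • ξ + t • η) = 0 := by rw [hst, map_zero]
    simp only [map_add, map_smul, smul_eq_mul, g.form_symm x η ξ, hξη, mul_zero, zero_add] at h1
    have ht : t = 0 := (mul_eq_zero.mp h1).resolve_right hneg.ne
    subst ht
    simpa [hξ] using hst
  -- If `η` were timelike, the form would be nonpositive on the plane spanned by `ξ` and `η`,
  -- forcing $n + 2 \le n + 1$.
  have hle := QuadraticForm.sigPos_add_finrank_le_of_nonpos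
    (Q := LinearMap.BilinMap.toQuadraticMap (g.form x).toLinearMap₁₂)
    (V := Submodule.span ℝ (Set.range ![ξ, η])) (by
      intro v hv
      simp only [Matrix.range_cons, Matrix.range_empty, Set.union_empty, Set.singleton_union,
        Submodule.mem_span_pair] at hv
      obtain ⟨s, t, rfl⟩ := hv
      simp [hξξ, hξη, g.form_symm x η ξ]
      nlinarith [mul_self_nonneg t])
  rw [finrank_span_eq_card hind, g.sigPos_form, finrank_euclideanSpace_fin] at hle
  simp at hle

/-- The metric in a chart, as a field of bilinear forms on the model space. -/
noncomputable def chartForm (g : LorentzianMetric n M)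
    (e : OpenPartialHomeomorph M (EuclideanSpace ℝ (Fin (n + 1))))
    (z : EuclideanSpace ℝ (Fin (n + 1))) : EuclideanSpace ℝ (Fin (n + 1)) →L[ℝ]
    EuclideanSpace ℝ (Fin (n + 1)) →L[ℝ] ℝ :=
  let D : EuclideanSpace ℝ (Fin (n + 1)) →L[ℝ] EuclideanSpace ℝ (Fin (n + 1)) :=
    mfderiv (𝓡 (n + 1)) (𝓡 (n + 1)) e.symm z
  (g.form (e.symm z)).bilinearComp D D

theorem chartForm_apply (g : LorentzianMetric n M)
    (e : OpenPartialHomeomorph M (EuclideanSpace ℝ (Fin (n + 1))))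
    (z u v : EuclideanSpace ℝ (Fin (n + 1))) : g.chartForm e z u v =
      g.form (e.symm z) (mfderiv (𝓡 (n + 1)) (𝓡 (n + 1)) e.symm z u)
        (mfderiv (𝓡 (n + 1)) (𝓡 (n + 1)) e.symm z v) := rfl

theorem chartForm_symm (g : LorentzianMetric n M)
    (e : OpenPartialHomeomorph M (EuclideanSpace ℝ (Fin (n + 1))))
    (z u v : EuclideanSpace ℝ (Fin (n + 1))) : g.chartForm e z u v = g.chartForm e z v u :=
  g.form_symm _ _ _

theorem coeff_eq_chartForm (g : LorentzianMetric n M)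
    (e : OpenPartialHomeomorph M (EuclideanSpace ℝ (Fin (n + 1))))
    (z : EuclideanSpace ℝ (Fin (n + 1))) (i j : Fin (n + 1)) : g.coeff e z i j =
      g.chartForm e z (EuclideanSpace.single i 1) (EuclideanSpace.single j 1) := rfl

variable {e : OpenPartialHomeomorph M (EuclideanSpace ℝ (Fin (n + 1)))}

theorem contMDiffWithinAt_val_apply (g : LorentzianMetric n M)
    {N : Type*} [TopologicalSpace N] {H' : Type*} [TopologicalSpace H'] {E' : Type*}
    [NormedAddCommGroup E'] [NormedSpace ℝ E'] {I : ModelWithCorners ℝ E' H'} [ChartedSpace H' N]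
    {b : N → M} {s : Set N} {z : N} {v w : ∀ q, TangentSpace (𝓡 (n + 1)) (b q)}
    (hv : ContMDiffWithinAt I (𝓡 (n + 1)).tangent ∞
      (fun q ↦ (v q : TangentBundle (𝓡 (n + 1)) M)) s z)
    (hw : ContMDiffWithinAt I (𝓡 (n + 1)).tangent ∞
      (fun q ↦ (w q : TangentBundle (𝓡 (n + 1)) M)) s z) :
    ContMDiffWithinAt I 𝓘(ℝ, ℝ) ∞ (fun q ↦ g.val (b q) (v q) (w q)) s z := by
  have hb : ContMDiffWithinAt I (𝓡 (n + 1)) ∞ b s z := by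
    rw [Bundle.contMDiffWithinAt_totalSpace] at hv
    exact hv.1
  have : ContMDiffWithinAt I ((𝓡 (n + 1)).prod 𝓘(ℝ, ℝ)) ∞
      (fun q ↦ Bundle.TotalSpace.mk' ℝ (E := Bundle.Trivial M ℝ) (b q)
        (g.val (b q) (v q) (w q))) s z := by
    apply ContMDiffWithinAt.clm_bundle_apply₂
      (F₁ := EuclideanSpace ℝ (Fin (n + 1))) (F₂ := EuclideanSpace ℝ (Fin (n + 1)))
    · exact ContMDiffAt.comp_contMDiffWithinAt z g.contMDiff.contMDiffAt hb
    · exact hv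
    · exact hw
  rw [Bundle.contMDiffWithinAt_totalSpace] at this
  exact this.2

/-- It suffices to evaluate on fixed vectors `u`, `v`. Their images under the derivative of `e.symm`
are smooth sections along `e.symm`, being the tangent map of `e.symm` applied to constant fields. -/
theorem contDiffOn_chartForm (g : LorentzianMetric n M)
    (he : e ∈ IsManifold.maximalAtlas (𝓡 (n + 1)) ∞ M) :
    ContDiffOn ℝ ∞ (g.chartForm e) e.target := by
  have hsymm := contMDiffOn_symm_of_mem_maximalAtlas he
  have : IsManifold (𝓡 (n + 1)) 1 M := IsManifold.of_le (n := ∞) (by simp)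
  have hsec : ∀ u : EuclideanSpace ℝ (Fin (n + 1)),
      ContMDiffOn (𝓡 (n + 1)) (𝓡 (n + 1)).tangent ∞
      (fun z ↦ (⟨e.symm z, mfderiv (𝓡 (n + 1)) (𝓡 (n + 1)) e.symm z u⟩ :
        TangentBundle (𝓡 (n + 1)) M)) e.target := by
    intro u
    have h1 := hsymm.contMDiffOn_tangentMapWithin (m := ∞) (by simp)
      e.open_target.uniqueMDiffOn
    have h2 : ContMDiffOn (𝓡 (n + 1)) (𝓡 (n + 1)).tangent ∞
      (fun z : EuclideanSpace ℝ (Fin (n + 1)) ↦ (⟨z, u⟩ :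
        TangentBundle (𝓡 (n + 1)) (EuclideanSpace ℝ (Fin (n + 1))))) e.target := by
      exact contMDiffOn_vectorSpace_iff_contDiffOn.mpr contDiffOn_const
    refine (h1.comp h2 (fun z hz ↦ hz)).congr fun z hz ↦ ?_
    simp only [Function.comp, tangentMapWithin]
    rw [mfderivWithin_of_isOpen e.open_target hz]
  rw [contDiffOn_clm_apply]
  intro u
  rw [contDiffOn_clm_apply]
  intro v
  rw [← contMDiffOn_iff_contDiffOn]
  intro z hz
  exact g.contMDiffWithinAt_val_apply (hsec u z hz) (hsec v z hz)

variable {X : Type*} [NormedAddCommGroup X] [NormedSpace ℝ X]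

theorem chartForm_fderiv_comp (g : LorentzianMetric n M)
    (he : e ∈ IsManifold.maximalAtlas (𝓡 (n + 1)) ∞ M) {f : X → M} {p : X}
    (hf : MDifferentiableAt 𝓘(ℝ, X) (𝓡 (n + 1)) f p) (hp : f p ∈ e.source) (u v : X) :
    g.chartForm e (e (f p)) (fderiv ℝ (fun q ↦ e (f q)) p u) (fderiv ℝ (fun q ↦ e (f q)) p v) =
      g.form (f p) (mfderiv 𝓘(ℝ, X) (𝓡 (n + 1)) f p u) (mfderiv 𝓘(ℝ, X) (𝓡 (n + 1)) f p v) := by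
  rw [chartForm_apply, e.left_inv hp]
  congr 1
  · congr 1
    exact mfderiv_symm_fderiv_comp he hf hp u
  · exact mfderiv_symm_fderiv_comp he hf hp v

end LorentzianMetric

/-! ### The pregeodesic equation: Christoffel symbols and chart independence -/

namespace LorentzianMetric

open Filter Topology

variable {n : ℕ} {M : Type*} [TopologicalSpace M]
  [ChartedSpace (EuclideanSpace ℝ (Fin (n + 1))) M] [IsManifold (𝓡 (n + 1)) ∞ M]
  {e e' : OpenPartialHomeomorph M (EuclideanSpace ℝ (Fin (n + 1)))}

theorem chartForm_nondegenerate (g : LorentzianMetric n M)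
    (he : e ∈ IsManifold.maximalAtlas (𝓡 (n + 1)) ∞ M) {z v : EuclideanSpace ℝ (Fin (n + 1))}
    (hz : z ∈ e.target) (hv : ∀ w, g.chartForm e z v w = 0) : v = 0 := by
  have hb := (mdifferentiable_of_mem_maximalAtlas he).symm.mfderiv_bijective hz
  have h0 : (mfderiv (𝓡 (n + 1)) (𝓡 (n + 1)) e.symm z v : EuclideanSpace ℝ (Fin (n + 1))) = 0 := by
    apply g.form_nondegenerate (e.symm z)
    intro w
    obtain ⟨w', rfl⟩ := hb.2 w
    exact hv w'
  exact hb.1 (h0.trans (map_zero _).symm)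

theorem differentiableAt_chartForm (g : LorentzianMetric n M)
    (he : e ∈ IsManifold.maximalAtlas (𝓡 (n + 1)) ∞ M) {z : EuclideanSpace ℝ (Fin (n + 1))}
    (hz : z ∈ e.target) : DifferentiableAt ℝ (g.chartForm e) z :=
  ((g.contDiffOn_chartForm he).contDiffAt (e.open_target.mem_nhds hz)).differentiableAt (by simp)

theorem sum_smul_single (v : EuclideanSpace ℝ (Fin (n + 1))) :
    v = ∑ i, v i • EuclideanSpace.single i (1 : ℝ) := by
  ext k
  simp [Finset.sum_apply, Pi.single_apply]

theorem coeff_mulVec (g : LorentzianMetric n M) (z v : EuclideanSpace ℝ (Fin (n + 1)))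
    (l : Fin (n + 1)) : (g.coeff e z).mulVec v l = g.chartForm e z v (EuclideanSpace.single l 1) := by
  rw [g.chartForm_symm e z v]
  conv_rhs => rw [sum_smul_single v]
  simp [Matrix.mulVec, dotProduct, coeff_eq_chartForm, mul_comm]

theorem isUnit_coeff (g : LorentzianMetric n M)
    (he : e ∈ IsManifold.maximalAtlas (𝓡 (n + 1)) ∞ M) {z : EuclideanSpace ℝ (Fin (n + 1))}
    (hz : z ∈ e.target) : IsUnit (g.coeff e z) := by
  rw [← Matrix.mulVec_injective_iff_isUnit, ← Matrix.coe_mulVecLin, injective_iff_map_eq_zero (g.coeff e z).mulVecLin]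
  intro v hv
  have h0 : (WithLp.toLp 2 v : EuclideanSpace ℝ (Fin (n + 1))) = 0 := by
    apply g.chartForm_nondegenerate he hz
    intro w
    rw [sum_smul_single w]
    simp only [map_sum, map_smul, ← coeff_mulVec]
    have hv' : (g.coeff e z).mulVec v = 0 := hv
    simp [hv']
  simpa using h0

theorem partialDeriv_coeff (g : LorentzianMetric n M)
    (he : e ∈ IsManifold.maximalAtlas (𝓡 (n + 1)) ∞ M) {z : EuclideanSpace ℝ (Fin (n + 1))}
    (hz : z ∈ e.target) (i j k : Fin (n + 1)) :
    partialDeriv i (fun q ↦ g.coeff e q j k) z =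
      fderiv ℝ (g.chartForm e) z (EuclideanSpace.single i 1) (EuclideanSpace.single j 1)
        (EuclideanSpace.single k 1) := by
  simp only [partialDeriv, coeff_eq_chartForm]
  exact fderiv_form_apply (g.differentiableAt_chartForm he hz) _ _ _

/-- The coordinate form of a pregeodesic equation in terms of the Euler–Lagrange covector. -/
theorem christoffel_eq_of_eulerLagrange (g : LorentzianMetric n M)
    (he : e ∈ IsManifold.maximalAtlas (𝓡 (n + 1)) ∞ M) {y v a : EuclideanSpace ℝ (Fin (n + 1))}
    (hy : y ∈ e.target) {α : ℝ}
    (h : ∀ w, eulerLagrange (g.chartForm e) y v a w = α * g.chartForm e y v w) (k : Fin (n + 1)) :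
    a k + ∑ i, ∑ j, g.christoffel e k i j y * v i * v j = α * v k := by
  set D : Fin (n + 1) → Fin (n + 1) → Fin (n + 1) → ℝ := fun i j l ↦
    fderiv ℝ (g.chartForm e) y (EuclideanSpace.single i 1) (EuclideanSpace.single j 1)
      (EuclideanSpace.single l 1) with hD
  have hD1 : ∀ l, fderiv ℝ (g.chartForm e) y v v (EuclideanSpace.single l 1) =
      ∑ i, ∑ j, D i j l * v i * v j := by
    intro l
    conv_lhs => rw [sum_smul_single v]
    simp only [map_sum, map_smul, sum_apply, smul_apply, smul_eq_mul, Finset.mul_sum, hD]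
    rw [Finset.sum_comm]
    refine Finset.sum_congr rfl fun i _ ↦ Finset.sum_congr rfl fun j _ ↦ ?_
    ring
  have hD2 : ∀ l, fderiv ℝ (g.chartForm e) y (EuclideanSpace.single l 1) v v =
      ∑ i, ∑ j, D l i j * v i * v j := by
    intro l
    conv_lhs => rw [sum_smul_single v]
    simp only [map_sum, map_smul, sum_apply, smul_apply, smul_eq_mul, Finset.mul_sum, hD]
    rw [Finset.sum_comm]
    refine Finset.sum_congr rfl fun i _ ↦ Finset.sum_congr rfl fun j _ ↦ ?_
    ring
  -- The Christoffel symbols of the first kind contracted twice with `v`, before symmetrising in the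
  -- first two indices.
  set C : Fin (n + 1) → ℝ := fun l ↦
    ∑ i, ∑ j, D i j l * v i * v j - (1 / 2 : ℝ) * ∑ i, ∑ j, D l i j * v i * v j with hC
  have hlower : (g.coeff e y).mulVec (a - α • v : EuclideanSpace ℝ (Fin (n + 1))) = -C := by
    ext l
    rw [coeff_mulVec]
    have hl := h (EuclideanSpace.single l 1)
    rw [eulerLagrange, hD1, hD2] at hl
    simp only [map_sub, map_smul, sub_apply, smul_apply, smul_eq_mul, Pi.neg_apply, hC]
    linarith
  have hdet : IsUnit (g.coeff e y).det :=
    (Matrix.isUnit_iff_isUnit_det _).mp (g.isUnit_coeff he hy)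
  have hraise := congrFun (congrArg ((g.coeff e y)⁻¹.mulVec ·) hlower) k
  simp only [Matrix.mulVec_mulVec, Matrix.nonsing_inv_mul _ hdet, Matrix.one_mulVec] at hraise
  -- Contraction with $v^iv^j$ sees only the symmetric part, so the single term $\partial_i g_{jl}$
  -- may be replaced by half of $\partial_i g_{jl} + \partial_j g_{il}$.
  have hswap : ∀ l, ∑ i, ∑ j, D j i l * v i * v j = ∑ i, ∑ j, D i j l * v i * v j := by
    intro l
    rw [Finset.sum_comm]
    refine Finset.sum_congr rfl fun i _ ↦ Finset.sum_congr rfl fun j _ ↦ ?_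
    ring
  have hC' : ∀ l, C l = ∑ i, ∑ j, (1 / 2 : ℝ) * ((D i j l + D j i l - D l i j) * v i * v j) := by
    intro l
    simp only [← Finset.mul_sum, sub_mul, add_mul, Finset.sum_sub_distrib, Finset.sum_add_distrib,
      hswap, hC]
    ring
  have hΓ : ∑ i, ∑ j, g.christoffel e k i j y * v i * v j = ((g.coeff e y)⁻¹.mulVec C) k := by
    simp only [christoffel, partialDeriv_coeff g he hy, Matrix.mulVec, dotProduct, hC',
      Finset.mul_sum, Finset.sum_mul]
    refine Eq.symm (Finset.sum_comm.trans (Finset.sum_congr rfl fun i _ ↦ Finset.sum_comm.trans ?_))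
    refine Finset.sum_congr rfl fun j _ ↦ Finset.sum_congr rfl fun l _ ↦ ?_
    simp only [hD]
    ring
  rw [hΓ]
  rw [Matrix.mulVec_neg] at hraise
  simp only [PiLp.sub_apply, PiLp.smul_apply, smul_eq_mul, Pi.neg_apply] at hraise
  linarith

/-- The equation `∇_{γ'} γ' = α γ'` at parameter `t`, in covector form in the chart `e`. -/
def IsPregeodesicAt (g : LorentzianMetric n M)
    (e : OpenPartialHomeomorph M (EuclideanSpace ℝ (Fin (n + 1)))) (γ : ℝ → M) (t α : ℝ) : Prop :=
  ∀ w, eulerLagrange (g.chartForm e) (e (γ t)) (deriv (fun s ↦ e (γ s)) t)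
    (deriv (deriv fun s ↦ e (γ s)) t) w = α * g.chartForm e (e (γ t)) (deriv (fun s ↦ e (γ s)) t) w

theorem chartForm_eventuallyEq_pullbackForm (g : LorentzianMetric n M)
    (he : e ∈ IsManifold.maximalAtlas (𝓡 (n + 1)) ∞ M)
    (he' : e' ∈ IsManifold.maximalAtlas (𝓡 (n + 1)) ∞ M) {z : EuclideanSpace ℝ (Fin (n + 1))}
    (hz : z ∈ e.target) (hz' : e.symm z ∈ e'.source) :
    g.chartForm e =ᶠ[𝓝 z] pullbackForm (fun q ↦ e' (e.symm q)) (g.chartForm e') := by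
  filter_upwards [e.open_target.mem_nhds hz,
    (e.continuousAt_symm hz).preimage_mem_nhds (e'.open_source.mem_nhds hz')] with q hq hq'
  ext u v
  exact (g.chartForm_fderiv_comp he' ((mdifferentiable_of_mem_maximalAtlas he).mdifferentiableAt_symm hq) hq' u v).symm

/-- The pregeodesic equation does not depend on the chart. -/
theorem IsPregeodesicAt.change_chart {g : LorentzianMetric n M}
    (he : e ∈ IsManifold.maximalAtlas (𝓡 (n + 1)) ∞ M)
    (he' : e' ∈ IsManifold.maximalAtlas (𝓡 (n + 1)) ∞ M) {γ : ℝ → M} {t α : ℝ}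
    (hγ : ContMDiffAt 𝓘(ℝ, ℝ) (𝓡 (n + 1)) ∞ γ t) (ht : γ t ∈ e.source) (ht' : γ t ∈ e'.source)
    (h : g.IsPregeodesicAt e γ t α) : g.IsPregeodesicAt e' γ t α := by
  have hz := e.map_source ht
  have hz' : e.symm (e (γ t)) ∈ e'.source := by rwa [e.left_inv ht]
  have hφ := contDiffAt_transition he he' hz hz'
  have hx := contDiffAt_chart_curve he hγ ht
  have hy : (fun s ↦ e' (γ s)) =ᶠ[𝓝 t] fun s ↦ e' (e.symm (e (γ s))) := by
    filter_upwards [hγ.continuousAt.preimage_mem_nhds (e.open_source.mem_nhds ht)] with s hs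
    rw [e.left_inv hs]
  have hpull := g.chartForm_eventuallyEq_pullbackForm he he' hz hz'
  intro w
  -- Naturality only reaches test vectors in the image of the derivative; for a transition map these
  -- are all vectors.
  obtain ⟨w, rfl⟩ := surjective_fderiv_transition he he' hz hz' w
  rw [eulerLagrange_curve (x := fun s ↦ e (γ s)) (y := fun s ↦ e' (γ s)) (hφ.of_le ENat.LEInfty.out)
    (hx.of_le ENat.LEInfty.out) hy (g.differentiableAt_chartForm he' (e'.map_source ht'))
    (g.chartForm_symm e' _), ← eulerLagrange_congr hpull, h w, hpull.eq_of_nhds, hy.deriv_eq,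
    deriv_comp_curve (x := fun s ↦ e (γ s)) (hφ.differentiableAt (by simp))
      (hx.differentiableAt (by simp)), pullbackForm_apply, e.left_inv ht]

variable {V : Type*} [TopologicalSpace V] [ChartedSpace (EuclideanSpace ℝ (Fin n)) V]

theorem IsLightlikeHypersurface.form_mfderiv_nonneg {g : LorentzianMetric n M} {ι : V → M}
    (hV : g.IsLightlikeHypersurface ι) (p : V) (u : TangentSpace (𝓡 n) p) :
    0 ≤ g.form (ι p) (mfderiv (𝓡 n) (𝓡 (n + 1)) ι p u) (mfderiv (𝓡 n) (𝓡 (n + 1)) ι p u) := by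
  obtain ⟨ξ, hξ, h⟩ := hV.lightlike p
  refine g.form_nonneg_of_orthogonal (ι p) (ξ := mfderiv (𝓡 n) (𝓡 (n + 1)) ι p ξ) ?_ (h ξ) (h u)
  exact fun h0 ↦ hξ (hV.mfderiv_injective p (h0.trans (map_zero _).symm))

end LorentzianMetric

/-! ### From the hypersurface to the ambient space -/

section EulerLagrange

/-- The Euler–Lagrange covector as a linear functional. -/
noncomputable def eulerLagrangeDual {F : Type*} [NormedAddCommGroup F] [NormedSpace ℝ F]
    (H : F → F →L[ℝ] F →L[ℝ] ℝ) (y v a : F) : Module.Dual ℝ F where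
  toFun := eulerLagrange H y v a
  map_add' p q := by simp only [eulerLagrange, map_add, add_apply]; ring
  map_smul' c p := by 
    simp only [eulerLagrange, map_smul, smul_apply, smul_eq_mul, RingHom.id_apply]; ring

open Filter Topology in
/-- If a semidefinite field of forms on a hypersurface is induced by a nondegenerate one, then
the isotropic curves of the former are pregeodesics of the latter. -/
theorem exists_eulerLagrange_eq_mul {E F : Type*} [NormedAddCommGroup E] [NormedSpace ℝ E]
    [NormedAddCommGroup F] [NormedSpace ℝ F] [FiniteDimensional ℝ F]
    {φ : E → F} {H : F → F →L[ℝ] F →L[ℝ] ℝ} {x : ℝ → E} {y : ℝ → F} {t : ℝ}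
    (hφ : ContDiffAt ℝ 2 φ (x t)) (hx : ContDiffAt ℝ 2 x t) (hyx : y =ᶠ[𝓝 t] fun s ↦ φ (x s))
    (hH : DifferentiableAt ℝ H (y t)) (hsymm : ∀ z u v, H z u v = H z v u)
    (hne : ∃ w, H (y t) (deriv y t) w ≠ 0)
    (hpos : ∀ᶠ z in 𝓝 (x t), ∀ u, 0 ≤ pullbackForm φ H z u u)
    (hiso : ∀ᶠ s in 𝓝 t, H (y s) (deriv y s) (deriv y s) = 0)
    (hinj : Function.Injective (fderiv ℝ φ (x t)))
    (hdim : Module.finrank ℝ F = Module.finrank ℝ E + 1) :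
    ∃ α : ℝ, ∀ w, eulerLagrange H (y t) (deriv y t) (deriv (deriv y) t) w =
      α * H (y t) (deriv y t) w := by
  have hsymm' : ∀ z u v, pullbackForm φ H z u v = pullbackForm φ H z v u :=
    fun z u v ↦ hsymm _ _ _
  have hiso' : ∀ᶠ s in 𝓝 t, pullbackForm φ H (x s) (deriv x s) (deriv x s) = 0 := by
    filter_upwards [hiso, hyx.eventuallyEq_nhds, hx.continuousAt.eventually
      (hφ.eventually (by simp)), hx.eventually (by simp)] with s h0 h1 h2 h3
    rw [pullbackForm_apply, ← deriv_comp_curve (h2.differentiableAt (by norm_num))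
      (h3.differentiableAt (by norm_num)), ← h1.deriv_eq, ← h1.eq_of_nhds]
    exact h0
  -- On vectors tangent to the hypersurface the ambient covector is that of the induced form, which
  -- vanishes by extremality.
  have hEL : ∀ w, eulerLagrange H (y t) (deriv y t) (deriv (deriv y) t) (fderiv ℝ φ (x t) w) = 0 :=
    fun w ↦ by
    rw [eulerLagrange_curve hφ hx hyx hH (hsymm _)]
    exact eulerLagrange_eq_zero_of_isotropic hx
      (differentiableAt_pullbackForm hφ (hyx.eq_of_nhds ▸ hH)) (.of_forall hsymm') hpos hiso' w
  have hvel : ∀ w, H (y t) (deriv y t) (fderiv ℝ φ (x t) w) = 0 := fun w ↦ by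
    rw [hyx.deriv_eq, hyx.eq_of_nhds, deriv_comp_curve (hφ.differentiableAt (by norm_num))
      (hx.differentiableAt (by norm_num))]
    exact apply_eq_zero_of_nonneg (hsymm' _) hpos.self_of_nhds hiso'.self_of_nhds w
  obtain ⟨w, hw⟩ := hne
  obtain ⟨α, hα⟩ := exists_eq_smul_of_vanish_on_hyperplane
    (fderiv ℝ φ (x t)).toLinearMap hinj hdim (f := (H (y t) (deriv y t)).toLinearMap)
    (g := eulerLagrangeDual H (y t) (deriv y t) (deriv (deriv y) t))
    (fun h0 ↦ hw (LinearMap.congr_fun h0 w)) hvel hEL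
  exact ⟨α, fun w ↦ LinearMap.congr_fun hα w⟩

set_option maxSynthPendingDepth 4 in
theorem contDiffAt_eulerLagrange {F : Type*} [NormedAddCommGroup F] [NormedSpace ℝ F]
    {H : F → F →L[ℝ] F →L[ℝ] ℝ} {y : ℝ → F} {t : ℝ} (hy : ContDiffAt ℝ ∞ y t)
    (hH : ContDiffAt ℝ ∞ H (y t)) (w : F) :
    ContDiffAt ℝ ∞ (fun s ↦ eulerLagrange H (y s) (deriv y s) (deriv (deriv y) s) w) t := by
  have hd : ∀ {x : ℝ → F}, ContDiffAt ℝ ∞ x t → ContDiffAt ℝ ∞ (deriv x) t := fun hx ↦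
    (hx.fderiv_right (m := ∞) (by simp)).clm_apply contDiffAt_const
  have h1 := hd hy
  have h2 := hd h1
  have hHy : ContDiffAt ℝ ∞ (fun s ↦ H (y s)) t := hH.comp t hy
  have hDy : ContDiffAt ℝ ∞ (fun s ↦ fderiv ℝ H (y s)) t :=
    (hH.fderiv_right (m := ∞) (by simp)).comp t hy
  exact (((hHy.clm_apply h2).clm_apply contDiffAt_const).add
    (((hDy.clm_apply h1).clm_apply h1).clm_apply contDiffAt_const)).sub
    (contDiffAt_const.mul (((hDy.clm_apply contDiffAt_const).clm_apply h1).clm_apply h1))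

end EulerLagrange

/-! ### Immersions and curves read in charts -/

section Charts

variable {m : ℕ} {M : Type*} [TopologicalSpace M] [ChartedSpace (EuclideanSpace ℝ (Fin m)) M]
  {e : OpenPartialHomeomorph M (EuclideanSpace ℝ (Fin m))}
  {l : ℕ} {V : Type*} [TopologicalSpace V] [ChartedSpace (EuclideanSpace ℝ (Fin l)) V]

theorem deriv_chart_curve_ne_zero (he : e ∈ IsManifold.maximalAtlas (𝓡 m) ∞ M)
    {γ : ℝ → M} {t : ℝ} (hγ : ContMDiffAt 𝓘(ℝ, ℝ) (𝓡 m) ∞ γ t) (ht : γ t ∈ e.source)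
    (hreg : curveVelocity m γ t ≠ 0) : deriv (fun s ↦ e (γ s)) t ≠ 0 := by
  intro h0
  have h1 := mfderiv_symm_fderiv_comp he (hγ.mdifferentiableAt (by simp)) ht (1 : ℝ)
  rw [fderiv_apply_one_eq_deriv, h0] at h1
  exact hreg (h1.symm.trans (map_zero _))

theorem mfderiv_comp_curve {ι : V → M} {c : ℝ → V} {t : ℝ}
    (hι : ContMDiff (𝓡 l) (𝓡 m) ∞ ι) (hc : ContMDiffAt 𝓘(ℝ, ℝ) (𝓡 l) ∞ c t) :
    (mfderiv 𝓘(ℝ, ℝ) (𝓡 m) (ι ∘ c) t (1 : ℝ) : EuclideanSpace ℝ (Fin m)) =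
      mfderiv (𝓡 l) (𝓡 m) ι (c t) (curveVelocity l c t) := by
  rw [mfderiv_comp (I' := 𝓡 l) t (hι.mdifferentiableAt (by simp)) (hc.mdifferentiableAt (by simp))]
  rfl

theorem mfderiv_comp_symm {ι : V → M} (hι : ContMDiff (𝓡 l) (𝓡 m) ∞ ι)
    {κ : OpenPartialHomeomorph V (EuclideanSpace ℝ (Fin l))}
    (hκ : κ ∈ IsManifold.maximalAtlas (𝓡 l) ∞ V) {z : EuclideanSpace ℝ (Fin l)} (hz : z ∈ κ.target)
    (u : EuclideanSpace ℝ (Fin l)) :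
    (mfderiv (𝓡 l) (𝓡 m) (ι ∘ κ.symm) z u : EuclideanSpace ℝ (Fin m)) =
      mfderiv (𝓡 l) (𝓡 m) ι (κ.symm z) (mfderiv (𝓡 l) (𝓡 l) κ.symm z u) := by
  rw [mfderiv_comp (I' := 𝓡 l) z (hι.mdifferentiableAt (by simp))
    ((mdifferentiable_of_mem_maximalAtlas hκ).mdifferentiableAt_symm hz)]
  rfl

theorem contMDiffAt_comp_symm {ι : V → M} (hι : ContMDiff (𝓡 l) (𝓡 m) ∞ ι)
    {κ : OpenPartialHomeomorph V (EuclideanSpace ℝ (Fin l))}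
    (hκ : κ ∈ IsManifold.maximalAtlas (𝓡 l) ∞ V) {z : EuclideanSpace ℝ (Fin l)}
    (hz : z ∈ κ.target) : ContMDiffAt (𝓡 l) (𝓡 m) ∞ (ι ∘ κ.symm) z :=
  hι.contMDiffAt.comp z (contMDiffAt_symm_of_mem_maximalAtlas hκ hz)

theorem injective_fderiv_comp_symm {ι : V → M} (hι : ContMDiff (𝓡 l) (𝓡 m) ∞ ι)
    (hinj : ∀ p, Function.Injective (mfderiv (𝓡 l) (𝓡 m) ι p))
    {κ : OpenPartialHomeomorph V (EuclideanSpace ℝ (Fin l))}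
    (hκ : κ ∈ IsManifold.maximalAtlas (𝓡 l) ∞ V) (he : e ∈ IsManifold.maximalAtlas (𝓡 m) ∞ M)
    {z : EuclideanSpace ℝ (Fin l)} (hz : z ∈ κ.target) (hze : (ι ∘ κ.symm) z ∈ e.source) :
    Function.Injective (fderiv ℝ (fun q ↦ e ((ι ∘ κ.symm) q)) z) := by
  intro u v huv
  have hd := (contMDiffAt_comp_symm hι hκ hz).mdifferentiableAt (by simp)
  have h1 := mfderiv_symm_fderiv_comp he hd hze u
  have h2 := mfderiv_symm_fderiv_comp he hd hze v
  rw [huv] at h1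
  have h3 := (mfderiv_comp_symm hι hκ hz u).symm.trans
    ((h1.symm.trans h2).trans (mfderiv_comp_symm hι hκ hz v))
  exact (mdifferentiable_of_mem_maximalAtlas hκ).symm.mfderiv_injective hz (hinj _ h3)

end Charts

/-! ### Isotropic lines are pregeodesics -/

namespace LorentzianMetric

open Filter Topology

variable {n : ℕ} {M : Type*} [TopologicalSpace M]
  [ChartedSpace (EuclideanSpace ℝ (Fin (n + 1))) M] [IsManifold (𝓡 (n + 1)) ∞ M]
  {e : OpenPartialHomeomorph M (EuclideanSpace ℝ (Fin (n + 1)))}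

/-- The factor in the pregeodesic equation depends smoothly on the parameter. -/
theorem contDiffAt_of_isPregeodesicAt (g : LorentzianMetric n M)
    (he : e ∈ IsManifold.maximalAtlas (𝓡 (n + 1)) ∞ M) {γ : ℝ → M} {t : ℝ} {α : ℝ → ℝ}
    (hγ : ContMDiffAt 𝓘(ℝ, ℝ) (𝓡 (n + 1)) ∞ γ t) (ht : γ t ∈ e.source)
    (hreg : curveVelocity (n + 1) γ t ≠ 0)
    (hα : ∀ᶠ s in 𝓝 t, g.IsPregeodesicAt e γ s (α s)) : ContDiffAt ℝ ∞ α t := by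
  have hy := contDiffAt_chart_curve he hγ ht
  have hz := e.map_source ht
  have hH := (g.contDiffOn_chartForm he).contDiffAt (e.open_target.mem_nhds hz)
  -- One test vector, fixed at time `t`, keeps the denominator $g(\gamma',\zeta)$ nonzero at nearby
  -- times, so there `α` is a quotient of smooth functions.
  obtain ⟨ζ, hζ⟩ : ∃ ζ, g.chartForm e (e (γ t)) (deriv (fun s ↦ e (γ s)) t) ζ ≠ 0 := by
    by_contra! h
    exact deriv_chart_curve_ne_zero he hγ ht hreg (g.chartForm_nondegenerate he hz h)
  have hnum := contDiffAt_eulerLagrange (y := fun s ↦ e (γ s)) hy hH ζ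
  have hden : ContDiffAt ℝ ∞
      (fun s ↦ g.chartForm e (e (γ s)) (deriv (fun s ↦ e (γ s)) s) ζ) t :=
    ((ContDiffAt.comp (g := g.chartForm e) t hH hy).clm_apply
      ((hy.fderiv_right (m := ∞) (by simp)).clm_apply contDiffAt_const)).clm_apply contDiffAt_const
  refine (hnum.div hden hζ).congr_of_eventuallyEq ?_
  filter_upwards [hα, hden.continuousAt.eventually_ne hζ] with s hs hs0
  rw [Pi.div_apply, hs ζ]
  field_simp

theorem IsPregeodesicAt.geodesic_eq {g : LorentzianMetric n M}
    (he : e ∈ IsManifold.maximalAtlas (𝓡 (n + 1)) ∞ M) {γ : ℝ → M} {t α : ℝ}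
    (hγ : ContMDiffAt 𝓘(ℝ, ℝ) (𝓡 (n + 1)) ∞ γ t) (ht : γ t ∈ e.source)
    (h : g.IsPregeodesicAt e γ t α) (k : Fin (n + 1)) :
    deriv (deriv fun s ↦ e (γ s) k) t
        + ∑ i, ∑ j, g.christoffel e k i j (e (γ t))
          * deriv (fun s ↦ e (γ s) i) t * deriv (fun s ↦ e (γ s) j) t
        = α * deriv (fun s ↦ e (γ s) k) t := by
  have hy : ContDiffAt ℝ 2 (fun s ↦ e (γ s)) t :=
    (contDiffAt_chart_curve he hγ ht).of_le ENat.LEInfty.out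
  have hcoord : ∀ {x : ℝ → EuclideanSpace ℝ (Fin (n + 1))} {s : ℝ}, DifferentiableAt ℝ x s → ∀ i,
      deriv (fun s ↦ x s i) s = deriv x s i := fun hx i ↦
    ((EuclideanSpace.proj (𝕜 := ℝ) i).hasFDerivAt.comp_hasDerivAt _ hx.hasDerivAt).deriv
  have h1 := hcoord (hy.differentiableAt (by norm_num))
  have h2 : deriv (deriv fun s ↦ e (γ s) k) t = deriv (deriv fun s ↦ e (γ s)) t k := by
    rw [← hcoord hy.differentiableAt_deriv k]
    apply EventuallyEq.deriv_eq
    filter_upwards [hy.eventually (by simp)] with s hs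
    exact hcoord (hs.differentiableAt (by norm_num)) k
  simp only [h1, h2]
  exact g.christoffel_eq_of_eulerLagrange he (e.map_source ht) h k

variable {V : Type*} [TopologicalSpace V] [ChartedSpace (EuclideanSpace ℝ (Fin n)) V]

theorem IsLightlikeHypersurface.pullbackForm_nonneg {g : LorentzianMetric n M} {ι : V → M}
    (hV : g.IsLightlikeHypersurface ι) (he : e ∈ IsManifold.maximalAtlas (𝓡 (n + 1)) ∞ M)
    {κ : OpenPartialHomeomorph V (EuclideanSpace ℝ (Fin n))}
    (hκ : κ ∈ IsManifold.maximalAtlas (𝓡 n) ∞ V) {z : EuclideanSpace ℝ (Fin n)}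
    (hz : z ∈ κ.target) (hze : (ι ∘ κ.symm) z ∈ e.source) (u : EuclideanSpace ℝ (Fin n)) :
    0 ≤ pullbackForm (fun q ↦ e ((ι ∘ κ.symm) q)) (g.chartForm e) z u u := by
  have hd := (contMDiffAt_comp_symm hV.contMDiff hκ hz).mdifferentiableAt (by simp)
  refine (hV.form_mfderiv_nonneg (κ.symm z) (mfderiv (𝓡 n) (𝓡 n) κ.symm z u)).trans_eq ?_
  refine Eq.trans ?_ (g.chartForm_fderiv_comp he hd hze u u).symm
  exact congrArg (fun q : EuclideanSpace ℝ (Fin (n + 1)) ↦ g.form (ι (κ.symm z)) q q)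
    (mfderiv_comp_symm hV.contMDiff hκ hz u).symm

theorem IsIsotropicLine.contMDiffAt {g : LorentzianMetric n M} {ι : V → M} {c : ℝ → V} {J : Set ℝ}
    (hc : g.IsIsotropicLine ι c J) {t : ℝ} (ht : t ∈ J) : ContMDiffAt 𝓘(ℝ, ℝ) (𝓡 n) ∞ c t :=
  hc.contMDiffOn.contMDiffAt (hc.isOpen.mem_nhds ht)

theorem IsIsotropicLine.contMDiffAt_comp {g : LorentzianMetric n M} {ι : V → M} {c : ℝ → V}
    {J : Set ℝ} (hc : g.IsIsotropicLine ι c J) (hV : g.IsLightlikeHypersurface ι) {t : ℝ}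
    (ht : t ∈ J) : ContMDiffAt 𝓘(ℝ, ℝ) (𝓡 (n + 1)) ∞ (ι ∘ c) t :=
  hV.contMDiff.contMDiffAt.comp t (hc.contMDiffAt ht)

theorem IsIsotropicLine.regular_comp {g : LorentzianMetric n M} {ι : V → M} {c : ℝ → V}
    {J : Set ℝ} (hc : g.IsIsotropicLine ι c J) (hV : g.IsLightlikeHypersurface ι) {t : ℝ}
    (ht : t ∈ J) : curveVelocity (n + 1) (ι ∘ c) t ≠ 0 := fun h0 ↦
  hc.regular t ht <| hV.mfderiv_injective (c t) <|
    (mfderiv_comp_curve hV.contMDiff (hc.contMDiffAt ht)).symm.trans (h0.trans (map_zero _).symm)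

theorem IsIsotropicLine.chartForm_deriv {g : LorentzianMetric n M} {ι : V → M} {c : ℝ → V}
    {J : Set ℝ} (hc : g.IsIsotropicLine ι c J) (hV : g.IsLightlikeHypersurface ι)
    (he : e ∈ IsManifold.maximalAtlas (𝓡 (n + 1)) ∞ M) {t : ℝ} (ht : t ∈ J)
    (hte : (ι ∘ c) t ∈ e.source) :
    g.chartForm e (e ((ι ∘ c) t)) (deriv (fun s ↦ e ((ι ∘ c) s)) t)
      (deriv (fun s ↦ e ((ι ∘ c) s)) t) = 0 := by
  have hd := (hc.contMDiffAt_comp hV ht).mdifferentiableAt (by simp)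
  rw [← fderiv_apply_one_eq_deriv, g.chartForm_fderiv_comp he hd hte]
  refine Eq.trans ?_ (hc.isotropic t ht)
  exact congrArg (fun q : EuclideanSpace ℝ (Fin (n + 1)) ↦ g.form (ι (c t)) q q)
    (mfderiv_comp_curve hV.contMDiff (hc.contMDiffAt ht))

variable [IsManifold (𝓡 n) ∞ V]

/-- An isotropic line of a lightlike hypersurface satisfies the pregeodesic equation. -/
theorem IsIsotropicLine.exists_isPregeodesicAt {g : LorentzianMetric n M} {ι : V → M}
    (hV : g.IsLightlikeHypersurface ι) {c : ℝ → V} {J : Set ℝ} (hc : g.IsIsotropicLine ι c J)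
    {t : ℝ} (ht : t ∈ J) (he : e ∈ IsManifold.maximalAtlas (𝓡 (n + 1)) ∞ M)
    (hte : ι (c t) ∈ e.source) : ∃ α, g.IsPregeodesicAt e (ι ∘ c) t α := by
  set κ := chartAt (EuclideanSpace ℝ (Fin n)) (c t)
  have hκ : κ ∈ IsManifold.maximalAtlas (𝓡 n) ∞ V := IsManifold.chart_mem_maximalAtlas (c t)
  have htκ : c t ∈ κ.source := mem_chart_source _ _
  have hx := contDiffAt_chart_curve hκ (hc.contMDiffAt ht) htκ
  have hxt : κ (c t) ∈ κ.target := κ.map_source htκ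
  have hι := contMDiffAt_comp_symm hV.contMDiff hκ hxt
  have hxe : (ι ∘ κ.symm) (κ (c t)) ∈ e.source := by
    simpa only [Function.comp, κ.left_inv htκ] using hte
  have hφ : ContDiffAt ℝ ∞ (fun z ↦ e ((ι ∘ κ.symm) z)) (κ (c t)) := by
    rw [← contMDiffAt_iff_contDiffAt]
    exact (contMDiffAt_of_mem_maximalAtlas he hxe).comp (κ (c t)) hι
  have hyt : e ((ι ∘ c) t) ∈ e.target := e.map_source hte
  have hγ := hc.contMDiffAt_comp hV ht
  refine exists_eulerLagrange_eq_mul (x := fun s ↦ κ (c s)) (y := fun s ↦ e ((ι ∘ c) s))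
    (φ := fun z ↦ e ((ι ∘ κ.symm) z)) (hφ.of_le ENat.LEInfty.out) (hx.of_le ENat.LEInfty.out) ?_
    (g.differentiableAt_chartForm he hyt) (g.chartForm_symm e) ?_ ?_ ?_
    (injective_fderiv_comp_symm hV.contMDiff hV.mfderiv_injective hκ he hxt hxe) (by simp)
  · filter_upwards [(hc.contMDiffAt ht).continuousAt.preimage_mem_nhds
      (κ.open_source.mem_nhds htκ)] with s hs
    simp only [Function.comp, κ.left_inv hs]
  · by_contra! h
    exact deriv_chart_curve_ne_zero he hγ hte (hc.regular_comp hV ht)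
      (g.chartForm_nondegenerate he hyt h)
  · filter_upwards [κ.open_target.mem_nhds hxt,
      hι.continuousAt.preimage_mem_nhds (e.open_source.mem_nhds hxe)] with z hz hze
    exact hV.pullbackForm_nonneg he hκ hz hze
  · filter_upwards [hc.isOpen.mem_nhds ht,
      hγ.continuousAt.preimage_mem_nhds (e.open_source.mem_nhds hte)] with s hs hse
    exact hc.chartForm_deriv hV he hs hse

end LorentzianMetric

theorem theorem2 {n : ℕ} {M : Type*} [TopologicalSpace M]
    [ChartedSpace (EuclideanSpace ℝ (Fin (n + 1))) M] [IsManifold (𝓡 (n + 1)) ∞ M]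
    {V : Type*} [TopologicalSpace V] [ChartedSpace (EuclideanSpace ℝ (Fin n)) V]
    [IsManifold (𝓡 n) ∞ V]
    (g : LorentzianMetric n M) (ι : V → M) (hV : g.IsLightlikeHypersurface ι)
    (c : ℝ → V) (J : Set ℝ) (hc : g.IsIsotropicLine ι c J) :
    g.IsGeodesicLine (ι ∘ c) J := by
  -- The factor is chosen pointwise, in a chart that varies with `t`; its value outside `J` is
  -- irrelevant.
  have hex : ∀ t, ∃ α, t ∈ J →
      g.IsPregeodesicAt (chartAt (EuclideanSpace ℝ (Fin (n + 1))) (ι (c t))) (ι ∘ c) t α := by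
    intro t
    by_cases ht : t ∈ J
    · obtain ⟨α, hα⟩ := hc.exists_isPregeodesicAt hV ht
        (IsManifold.chart_mem_maximalAtlas (ι (c t))) (mem_chart_source _ _)
      exact ⟨α, fun _ ↦ hα⟩
    · exact ⟨0, fun h ↦ absurd h ht⟩
  choose α hα using hex
  -- Chart independence lets one fixed chart serve for all nearby parameters, which the smoothness
  -- of `α` requires.
  have hall : ∀ e ∈ IsManifold.maximalAtlas (𝓡 (n + 1)) ∞ M, ∀ t ∈ J, (ι ∘ c) t ∈ e.source →
      g.IsPregeodesicAt e (ι ∘ c) t (α t) := fun e he t ht hte ↦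
    (hα t ht).change_chart (IsManifold.chart_mem_maximalAtlas _) he (hc.contMDiffAt_comp hV ht)
      (mem_chart_source _ _) hte
  refine ⟨fun t ht ↦ (hc.contMDiffAt_comp hV ht).contMDiffWithinAt, fun t ht ↦ hc.regular_comp hV ht, α, fun t ht ↦ ?_,
    fun e he t ht hte k ↦ (hall e he t ht hte).geodesic_eq he (hc.contMDiffAt_comp hV ht) hte k⟩
  have hsrc := mem_chart_source (EuclideanSpace ℝ (Fin (n + 1))) (ι (c t))
  refine (g.contDiffAt_of_isPregeodesicAt (IsManifold.chart_mem_maximalAtlas (ι (c t))) (hc.contMDiffAt_comp hV ht)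
    hsrc (hc.regular_comp hV ht) ?_).contDiffWithinAt
  filter_upwards [hc.isOpen.mem_nhds ht, (hc.contMDiffAt_comp hV ht).continuousAt.preimage_mem_nhds
    ((chartAt (EuclideanSpace ℝ (Fin (n + 1))) (ι (c t))).open_source.mem_nhds hsrc)] with s hs hse
  exact hall _ (IsManifold.chart_mem_maximalAtlas _) s hs hse
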